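/- Let $N_{\mathbb R}$ be a finite-dimensional real vector space with an inner product $*$, and let $\Sigma$ be a simplicial fan in $N_{\mathbb R}$ (a finite collection of cones, each generated by linearly independent vectors, closed under taking faces and with any two cones meeting along a common face), together with a chosen generating vector $u_\rho$ of each ray $\rho\in\Sigma(1)$. Write $\Sigma(k)$ for the set of $k$-dimensional cones of $\Sigma$ and $\sigma(1)$ for the set of rays of a cone $\sigma$. Let $z\in\mathbb R^{\Sigma(1)}$ be pseudo-cubical with respect to $(\Sigma,*)$, i.e. for every $\tau\in\Sigma$ there is $v\in\tau$ with $v*u_\rho=z_\rho$ for all $\rho\in\tau(1)$. For $\sigma\in\Sigma(k)$ let \[ P_{\sigma,*}(z)=\{v\in\sigma \mid v*u_\rho\le z_\rho\text{ for all }\rho\in\sigma(1)\}, \] let $N_\sigma=\mathrm{span}_{\mathbb Z}(u_\rho\mid\rho\in\sigma(1))$ and $N_{\sigma,\mathbb R}=\mathrm{span}_{\mathbb R}(u_\rho\mid\rho\in\sigma(1))$, let $M_\sigma=\{v\in N_{\sigma,\mathbb R}\mid v*u\in\mathbb Z\text{ for all }u\in N_\sigma\}$ be the dual lattice, and let $\mathrm{Vol}_\sigma$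 be the translation-invariant volume on $N_{\sigma,\mathbb R}$ normalized so that a fundamental simplex of $M_\sigma$ (the convex hull of $0$ and a $\mathbb Z$-basis of $M_\sigma$) has volume one. Then for every $k$ and every $\sigma\in\Sigma(k)$, \[ \mathrm{Vol}_\sigma(P_{\sigma,*}(z))=\det(G_\sigma)\sum_{f}\ \prod_{j=1}^k\frac{\det\big(G_{\sigma(f,j),f(j)}(z)\big)}{\det\big(G_{\sigma(f,j)}\big)}, \] where the sum runs over all bijections $f:\{1,\dots,k\}\to\sigma(1)$; $\sigma(f,j)$ is the face of $\sigma$ with rays $\{f(i)\mid i\le j\}$; for a cone $\tau\in\Sigma$, $G_\tau=(u_\rho*u_\eta)_{\rho,\eta\in\tau(1)}$ is the Gram matrix of its ray generators; and, for $\rho\in\tau(1)$, $G_{\tau,\rho}(z)$ is obtained from $G_\tau$ by replacing its $\rho$th column with $(z_\eta)_{\eta\in\tau(1)}$. (Determinants of empty matrices and empty products equal $1$.) -/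

import Mathlib

open MeasureTheory Module Matrix

noncomputable section

/-! ### Lattice-normalized volume -/

section LatticeVolume

variable {E : Type*} [NormedAddCommGroup E] [InnerProductSpace ℝ E]

/-- `T` is a fundamental simplex of the full-rank lattice `L ⊆ E`: the convex hull of the origin
and the members of a `ℤ`-basis of `L` (a basis of `E` whose integral span is `L`). -/
def IsFundamentalSimplex (L : Submodule ℤ E) (T : Set E) : Prop :=
  ∃ b : Basis (Fin (finrank ℝ E)) ℝ E,
    Submodule.span ℤ (Set.range b) = L ∧ T = convexHull ℝ (insert 0 (Set.range b))

/-- The dual of the lattice `L`, regarded as a subgroup of `E` by means of the inner product: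
the vectors having integral inner product with every element of `L`. -/
def dualLattice (L : Submodule ℤ E) : Submodule ℤ E :=
  LinearMap.BilinForm.dualSubmodule (innerₗ E) L

/-- The dual of a full-rank lattice is again a full-rank lattice. -/
theorem exists_isFundamentalSimplex_dualLattice {ι : Type*} [Finite ι] (b : Basis ι ℝ E) :
    ∃ T : Set E, IsFundamentalSimplex (dualLattice (Submodule.span ℤ (Set.range b))) T := by
  classical
  have hB : LinearMap.BilinForm.Nondegenerate (innerₗ E) := by
    refine ⟨fun x hx => ?_, fun y hy => ?_⟩
    · exact inner_self_eq_zero.1 (hx x)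
    · exact inner_self_eq_zero.1 (hy y)
  have := Fintype.ofFinite ι
  let e : ι ≃ Fin (finrank ℝ E) := Fintype.equivFinOfCardEq (finrank_eq_card_basis b).symm
  refine ⟨_, (LinearMap.BilinForm.dualBasis (innerₗ E) hB b).reindex e, ?_, rfl⟩
  rw [Basis.range_reindex, dualLattice, LinearMap.BilinForm.dualSubmodule_span_of_basis _ hB]

variable [FiniteDimensional ℝ E] [MeasurableSpace E] [BorelSpace E]

open Classical in
/-- The translation-invariant measure on `E` for which the fundamental simplices of the lattice `L`
have measure one (see `latticeVolume_fundamentalSimplex`). It is set to zero if `L` is not a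
full-rank lattice. -/
def latticeVolume (L : Submodule ℤ E) : Measure E :=
  if h : ∃ T : Set E, IsFundamentalSimplex L T then
    (Measure.addHaar h.choose)⁻¹ • Measure.addHaar
  else 0

theorem IsFundamentalSimplex.addHaar_ne_zero {L : Submodule ℤ E} {T : Set E}
    (hT : IsFundamentalSimplex L T) : (Measure.addHaar : Measure E) T ≠ 0 := by
  obtain ⟨b, -, rfl⟩ := hT
  have h : (interior (convexHull ℝ (insert 0 (Set.range b)))).Nonempty := by
    rw [interior_convexHull_nonempty_iff_affineSpan_eq_top,
      AffineSubspace.affineSpan_eq_top_iff_vectorSpan_eq_top_of_nonempty ℝ E E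
        (Set.insert_nonempty _ _), vectorSpan_eq_span_vsub_set_right ℝ (Set.mem_insert _ _),
      eq_top_iff, ← b.span_eq]
    refine Submodule.span_mono ?_
    rintro _ ⟨i, rfl⟩
    exact ⟨b i, Set.mem_insert_of_mem _ ⟨i, rfl⟩, by simp⟩
  exact (Measure.measure_pos_of_nonempty_interior _ h).ne'

theorem IsFundamentalSimplex.addHaar_ne_top {L : Submodule ℤ E} {T : Set E}
    (hT : IsFundamentalSimplex L T) : (Measure.addHaar : Measure E) T ≠ ⊤ := by
  obtain ⟨b, -, rfl⟩ := hT
  exact (Set.Finite.isCompact_convexHull ℝ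
    ((Set.finite_range b).insert 0)).measure_lt_top.ne

theorem IsFundamentalSimplex.addHaar_eq {L : Submodule ℤ E} {T T' : Set E}
    (hT : IsFundamentalSimplex L T) (hT' : IsFundamentalSimplex L T') :
    (Measure.addHaar : Measure E) T = Measure.addHaar T' := by
  obtain ⟨b, hb, rfl⟩ := hT
  obtain ⟨b', hb', rfl⟩ := hT'
  have hdet : ENNReal.ofReal |b.det b'| = 1 := by
    have h1 := ZSpan.measure_fundamentalDomain b' (Measure.addHaar : Measure E) b
    have h2 : (Measure.addHaar : Measure E) (ZSpan.fundamentalDomain b) =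
        Measure.addHaar (ZSpan.fundamentalDomain b') := by
      have i1 := ZSpan.isAddFundamentalDomain b (Measure.addHaar : Measure E)
      have i2 := ZSpan.isAddFundamentalDomain b' (Measure.addHaar : Measure E)
      rw [hb'.trans hb.symm] at i2
      have : VAddInvariantMeasure (Submodule.span ℤ (Set.range b)) E
          (Measure.addHaar : Measure E) :=
        inferInstanceAs <|
          VAddInvariantMeasure (Submodule.span ℤ (Set.range b)).toAddSubgroup E Measure.addHaar
      exact i1.measure_eq i2
    rw [← h2] at h1
    have h0 : (Measure.addHaar : Measure E) (ZSpan.fundamentalDomain b) ≠ 0 :=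
      ZSpan.measure_fundamentalDomain_ne_zero b
    have ht : (Measure.addHaar : Measure E) (ZSpan.fundamentalDomain b) ≠ ⊤ :=
      (ZSpan.fundamentalDomain_isBounded b).measure_lt_top.ne
    exact (ENNReal.mul_eq_right h0 ht).1 h1.symm
  let f : E →ₗ[ℝ] E := (b.equiv b' (Equiv.refl _) : E →ₗ[ℝ] E)
  have hf : ∀ i, f (b i) = b' i := fun i => by simp [f]
  have himg : convexHull ℝ (insert 0 (Set.range b')) =
      f '' convexHull ℝ (insert 0 (Set.range b)) := by
    rw [f.image_convexHull, Set.image_insert_eq, map_zero, ← Set.range_comp]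
    congr 3
    ext i
    simp [hf]
  have hfd : LinearMap.det f = b.det b' := by
    rw [← LinearMap.det_toMatrix b, Basis.det_apply]
    congr 1
    ext i j
    rw [LinearMap.toMatrix_apply, hf, Basis.toMatrix_apply]
  rw [himg, Measure.addHaar_image_linearMap, hfd, hdet, one_mul]

/-- Every fundamental simplex of `L` has unit volume. -/
theorem latticeVolume_fundamentalSimplex {L : Submodule ℤ E} {T : Set E}
    (hT : IsFundamentalSimplex L T) : latticeVolume L T = 1 := by
  have h : ∃ T : Set E, IsFundamentalSimplex L T := ⟨T, hT⟩
  rw [latticeVolume, dif_pos h, Measure.smul_apply, smul_eq_mul, hT.addHaar_eq h.choose_spec]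
  exact ENNReal.inv_mul_cancel h.choose_spec.addHaar_ne_zero h.choose_spec.addHaar_ne_top

/-- The normalized volume is invariant under translations, finite on compact sets and positive on
nonempty open sets. -/
theorem isAddHaarMeasure_latticeVolume {L : Submodule ℤ E} {T : Set E}
    (hT : IsFundamentalSimplex L T) : (latticeVolume L).IsAddHaarMeasure := by
  have h : ∃ T : Set E, IsFundamentalSimplex L T := ⟨T, hT⟩
  rw [latticeVolume, dif_pos h]
  exact Measure.IsAddHaarMeasure.smul _
    (ENNReal.inv_ne_zero.2 h.choose_spec.addHaar_ne_top)
    (ENNReal.inv_ne_top.2 h.choose_spec.addHaar_ne_zero)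

end LatticeVolume

/-! ### Marked simplicial fans -/

section Cone

variable {V : Type*} [AddCommGroup V] [Module ℝ V]

/-- The dimension of a cone is the dimension of its linear span. -/
def coneDim (σ : PointedCone ℝ V) : ℕ :=
  finrank ℝ (Submodule.span ℝ (σ : Set V))

variable (V) in
/-- A marked polyhedral fan in `V`: a finite collection of polyhedral (finitely generated) cones,
closed under taking faces and such that any two cones meet along a common face, together with the
choice of a generating vector for each of its rays (one-dimensional cones). -/
structure MarkedFan where
  /-- the cones of the fan -/
  cones : Set (PointedCone ℝ V)
  finite_cones : cones.Finite
  fg : ∀ σ ∈ cones, σ.FG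
  mem_of_isFaceOf : ∀ σ ∈ cones, ∀ τ : PointedCone ℝ V, τ.IsFaceOf σ → τ ∈ cones
  inf_isFaceOf : ∀ σ ∈ cones, ∀ τ ∈ cones, (σ ⊓ τ).IsFaceOf σ
  /-- the chosen generators of the rays -/
  gen : {ρ : PointedCone ℝ V // ρ ∈ cones ∧ coneDim ρ = 1} → V
  hull_gen : ∀ ρ, PointedCone.hull ℝ {gen ρ} = ρ.1

namespace MarkedFan

variable (S : MarkedFan V)

/-- The rays of the fan, i.e. its one-dimensional cones. -/
abbrev Ray : Type _ := {ρ : PointedCone ℝ V // ρ ∈ S.cones ∧ coneDim ρ = 1}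

instance : Fintype S.Ray :=
  (S.finite_cones.subset fun _ h => h.1 : {ρ | ρ ∈ S.cones ∧ coneDim ρ = 1}.Finite).fintype

/-- The fan is simplicial if each of its cones is, i.e. if each of its cones is generated by
linearly independent vectors. -/
def IsSimplicial : Prop := ∀ σ ∈ S.cones, σ.IsSimplicial

/-- The set of `k`-dimensional cones of the fan. -/
def conesOfDim (k : ℕ) : Set (PointedCone ℝ V) := {σ | σ ∈ S.cones ∧ coneDim σ = k}

open Classical in
/-- The rays of a cone `σ`, i.e. its one-dimensional faces. -/
def raysOf (σ : PointedCone ℝ V) : Finset S.Ray :=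
  Finset.univ.filter fun ρ => ρ.1.IsFaceOf σ

/-- The linear subspace spanned by the generators of the rays of `σ`. -/
def spanOf (σ : PointedCone ℝ V) : Submodule ℝ V :=
  Submodule.span ℝ (Set.range fun ρ : S.raysOf σ => S.gen ρ)

/-- The generator of a ray of `σ`, as a vector of the subspace spanned by `σ`. -/
def genIn (σ : PointedCone ℝ V) (ρ : S.raysOf σ) : S.spanOf σ :=
  ⟨S.gen ρ, Submodule.subset_span ⟨ρ, rfl⟩⟩

/-- The subgroup generated by the ray generators of `σ`. -/
def latticeOf (σ : PointedCone ℝ V) : Submodule ℤ (S.spanOf σ) :=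
  Submodule.span ℤ (Set.range (S.genIn σ))

/-- The labelings of the rays of `σ` by `k` labels. -/
abbrev Labeling (k : ℕ) (σ : PointedCone ℝ V) : Type _ := Fin k ≃ S.raysOf σ

variable {S}

open Classical in
/-- The set of rays with label at most `j`. -/
def initialRays {k : ℕ} {σ : PointedCone ℝ V} (f : S.Labeling k σ) (j : Fin k) : Finset S.Ray :=
  (Finset.univ.filter fun i => i ≤ j).image fun i => (f i).1

theorem mem_initialRays {k : ℕ} {σ : PointedCone ℝ V} (f : S.Labeling k σ) (j : Fin k) :
    (f j).1 ∈ initialRays f j := by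
  classical
  exact Finset.mem_image.2 ⟨j, by simp, rfl⟩

end MarkedFan

end Cone

/-! ### Truncated cones and Gram matrices -/

namespace MarkedFan

variable {V : Type*} [NormedAddCommGroup V] [InnerProductSpace ℝ V] (S : MarkedFan V)

/-- `z` is pseudo-cubical: for each cone `σ`, the hyperplanes `v * u_ρ = z_ρ` associated to the rays
of `σ` have a common point in `σ`. -/
def IsPseudoCubical (z : S.Ray → ℝ) : Prop :=
  ∀ σ ∈ S.cones, ∃ v ∈ σ, ∀ ρ ∈ S.raysOf σ, inner ℝ v (S.gen ρ) = z ρ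

/-- The polytope obtained by truncating `σ` with the half-spaces `v * u_ρ ≤ z_ρ`. -/
def polytope (σ : PointedCone ℝ V) (z : S.Ray → ℝ) : Set V :=
  {v | v ∈ σ ∧ ∀ ρ ∈ S.raysOf σ, inner ℝ v (S.gen ρ) ≤ z ρ}

/-- The volume of subsets of the span of `σ`, normalized so that the fundamental simplices of the
dual of the lattice generated by the ray generators of `σ` have unit volume. -/
def vol [FiniteDimensional ℝ V] [MeasurableSpace V] [BorelSpace V]
    (σ : PointedCone ℝ V) (P : Set V) : ℝ :=
  (latticeVolume (dualLattice (S.latticeOf σ))).real ((fun v : S.spanOf σ => (v : V)) ⁻¹' P)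

/-- The Gram matrix of the generators of a set of rays. -/
def gramMatrix (A : Finset S.Ray) : Matrix A A ℝ :=
  Matrix.of fun ρ η => inner ℝ (S.gen ρ) (S.gen η)

open Classical in
/-- The Gram matrix of a set of rays, with the column of the ray `ρ` replaced by the values
of `z`. -/
def gramMatrixReplace (A : Finset S.Ray) (ρ : A) (z : S.Ray → ℝ) : Matrix A A ℝ :=
  (S.gramMatrix A).updateCol ρ fun η => z η

section WellDefined

variable {S}

theorem gen_ne_zero (ρ : S.Ray) : S.gen ρ ≠ 0 := by
  intro h
  have h1 : coneDim (PointedCone.hull ℝ {S.gen ρ}) = 1 := by rw [S.hull_gen ρ]; exact ρ.2.2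
  rw [h, coneDim, PointedCone.hull, Submodule.span_zero_singleton] at h1
  have h2 : Submodule.span ℝ ((⊥ : PointedCone ℝ V) : Set V) = ⊥ :=
    Submodule.span_eq_bot.2 fun x hx => hx
  rw [h2, finrank_bot] at h1
  exact zero_ne_one h1

theorem IsSimplicial.exists_generators (hS : S.IsSimplicial) {σ : PointedCone ℝ V}
    (hσ : σ ∈ S.cones) : ∃ s : Set V, LinearIndepOn ℝ id s ∧ PointedCone.hull ℝ s = σ ∧
      (∀ ρ ∈ S.raysOf σ, ∃ y ∈ s, ∃ t : ℝ, 0 < t ∧ S.gen ρ = t • y) ∧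
      (∀ y ∈ s, ∃ ρ ∈ S.raysOf σ, ∃ t : ℝ, 0 < t ∧ y = t • S.gen ρ) := by
  obtain ⟨s, -, hli, rfl⟩ := hS σ hσ
  refine ⟨s, hli, rfl, fun ρ hρ => ?_, fun y hy => ?_⟩
  · have hface : ρ.1.IsFaceOf (PointedCone.hull ℝ s) := by simpa [raysOf] using hρ
    have hgρ : S.gen ρ ∈ ρ.1 := by
      rw [← S.hull_gen ρ]; exact PointedCone.subset_hull rfl
    obtain ⟨c, hc, hc0, hsum⟩ := PointedCone.mem_hull_set.1 (hface.le hgρ)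
    have hne : c ≠ 0 := by
      rintro rfl
      exact gen_ne_zero ρ (by simpa using hsum.symm)
    obtain ⟨y, hy⟩ := Finsupp.support_nonempty_iff.2 hne
    have hcy : 0 < c y := lt_of_le_of_ne (hc0 y) (Ne.symm (Finsupp.mem_support_iff.1 hy))
    have hyρ : y ∈ ρ.1 := by
      classical
      refine hface.mem_of_smul_add_mem (x := y) (a := c y)
        (y := ∑ x ∈ c.support.erase y, c x • x) (PointedCone.subset_hull (hc hy))
        (Submodule.sum_mem _ fun x hx => PointedCone.smul_mem _ (hc0 x)
          (PointedCone.subset_hull (hc (Finset.mem_of_mem_erase hx)))) hcy ?_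
      rw [Finset.add_sum_erase _ (fun x => c x • x) hy]
      change c.sum (fun m r => r • m) ∈ _
      rwa [hsum]
    rw [← S.hull_gen ρ] at hyρ
    obtain ⟨⟨t, ht⟩, rfl⟩ := Submodule.mem_span_singleton.1 hyρ
    have ht0 : t ≠ 0 := by
      rintro rfl
      exact hli.ne_zero (hc hy) (zero_smul ℝ (S.gen ρ))
    exact ⟨_, hc hy, t⁻¹, inv_pos.2 (lt_of_le_of_ne ht (Ne.symm ht0)),
      (inv_smul_smul₀ ht0 (S.gen ρ)).symm⟩
  · have hφ : ∀ i ∈ s, ∃ φ : V →ₗ[ℝ] ℝ, φ i = 1 ∧ ∀ j ∈ s, j ≠ i → φ j = 0 := by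
      intro i hi
      let b := Basis.extend hli
      have hsub := hli.subset_extend (Set.subset_univ s)
      refine ⟨b.coord ⟨i, hsub hi⟩, ?_, fun j hj hji => ?_⟩
      · have : b ⟨i, hsub hi⟩ = i := Basis.extend_apply_self hli _
        have h2 : b.coord ⟨i, hsub hi⟩ (b ⟨i, hsub hi⟩) = 1 := by simp
        rwa [this] at h2
      · have : b ⟨j, hsub hj⟩ = j := Basis.extend_apply_self hli _
        have h2 : b.coord ⟨i, hsub hi⟩ (b ⟨j, hsub hj⟩) = 0 := by
          rw [Basis.coord_apply, Basis.repr_self]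
          exact Finsupp.single_eq_of_ne fun h => hji (congrArg Subtype.val h).symm
        rwa [this] at h2
    have hy0 : y ≠ 0 := hli.ne_zero hy
    have hface : (PointedCone.hull ℝ {y}).IsFaceOf (PointedCone.hull ℝ s) := by
      refine ⟨Submodule.span_mono (by simpa using hy), fun {x w a} hx hw ha hxw => ?_⟩
      obtain ⟨c, hc, hc0, rfl⟩ := PointedCone.mem_hull_set.1 hx
      have key : ∀ i ∈ c.support, i ≠ y → c i = 0 := by
        intro i hi hiy
        obtain ⟨φ, hφi, hφj⟩ := hφ i (hc hi)
        have hpos : 0 ≤ φ w := by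
          obtain ⟨d, hd, hd0, rfl⟩ := PointedCone.mem_hull_set.1 hw
          rw [Finsupp.sum, map_sum]
          refine Finset.sum_nonneg fun j hj => ?_
          rw [map_smul, smul_eq_mul]
          refine mul_nonneg (hd0 j) ?_
          by_cases hji : j = i
          · rw [hji, hφi]; exact zero_le_one
          · rw [hφj j (hd hj) hji]
        have hx' : φ (c.sum fun m r => r • m) = c i := by
          rw [Finsupp.sum, map_sum, Finset.sum_eq_single i]
          · rw [map_smul, hφi, smul_eq_mul, mul_one]
          · intro j hj hji
            rw [map_smul, hφj j (hc hj) hji, smul_zero]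
          · intro h; exact absurd hi h
        obtain ⟨⟨t, ht⟩, hteq⟩ := Submodule.mem_span_singleton.1 hxw
        have h0 : φ (a • (c.sum fun m r => r • m) + w) = 0 := by
          rw [← hteq]
          change φ (t • y) = 0
          rw [map_smul, hφj y hy (Ne.symm hiy), smul_zero]
        rw [map_add, map_smul, hx', smul_eq_mul] at h0
        have := hc0 i
        nlinarith [mul_nonneg ha.le this]
      refine Submodule.sum_mem _ fun i hi => ?_
      by_cases hiy : i = y
      · exact PointedCone.smul_mem _ (hc0 i) (PointedCone.subset_hull hiy)
      · change c i • i ∈ _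
        rw [key i hi hiy, zero_smul]
        exact Submodule.zero_mem _
    have hmem := S.mem_of_isFaceOf _ hσ _ hface
    have hdim : coneDim (PointedCone.hull ℝ {y}) = 1 := by
      suffices h2 : Submodule.span ℝ (PointedCone.hull ℝ {y} : Set V) = Submodule.span ℝ {y} by
        rw [coneDim, h2, finrank_span_singleton hy0]
      refine le_antisymm (Submodule.span_le.2 (PointedCone.hull_le_span ℝ {y}))
        (Submodule.span_mono PointedCone.subset_hull)
    let ρ : S.Ray := ⟨PointedCone.hull ℝ {y}, hmem, hdim⟩
    have hyρ : y ∈ PointedCone.hull ℝ {S.gen ρ} := by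
      rw [S.hull_gen ρ]; exact PointedCone.subset_hull rfl
    obtain ⟨⟨t, ht⟩, hteq⟩ := Submodule.mem_span_singleton.1 hyρ
    refine ⟨ρ, by simpa [raysOf] using hface, t, lt_of_le_of_ne ht ?_, hteq.symm⟩
    rintro rfl
    exact hy0 (hteq.symm.trans (zero_smul ℝ (S.gen ρ)))

/-- The ray generators of a cone of a simplicial fan are linearly independent. -/
theorem IsSimplicial.linearIndependent_gen (hS : S.IsSimplicial) {σ : PointedCone ℝ V}
    (hσ : σ ∈ S.cones) : LinearIndependent ℝ fun ρ : S.raysOf σ => S.gen ρ := by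
  obtain ⟨s, hli, -, h, -⟩ := hS.exists_generators hσ
  choose! g hg t ht hgt using h
  have hinj : Function.Injective fun ρ : S.raysOf σ => (⟨g ρ, hg ρ ρ.2⟩ : s) := by
    intro ρ ρ' hρ
    have hρ' : g ρ = g ρ' := by simpa using hρ
    have key : ∀ ρ ∈ S.raysOf σ, ρ.1 = PointedCone.hull ℝ {g ρ} := by
      intro ρ hρ
      rw [← S.hull_gen ρ, hgt ρ hρ]
      refine le_antisymm (Submodule.span_le.2 ?_) (Submodule.span_le.2 ?_)
      · rintro _ rfl
        exact PointedCone.smul_mem _ (ht ρ hρ).le (PointedCone.subset_hull rfl)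
      · rintro _ rfl
        have := PointedCone.smul_mem (PointedCone.hull ℝ {t ρ • g ρ}) (inv_nonneg.2 (ht ρ hρ).le)
          (PointedCone.subset_hull rfl)
        rwa [inv_smul_smul₀ (ht ρ hρ).ne'] at this
    exact Subtype.ext (Subtype.ext ((key ρ ρ.2).trans
      ((congrArg (fun y => PointedCone.hull ℝ {y}) hρ').trans (key ρ' ρ'.2).symm)))
  have h2 := (LinearIndependent.comp hli _ hinj).units_smul
    fun ρ : S.raysOf σ => Units.mk0 (t ρ) (ht ρ ρ.2).ne'
  convert h2 using 1
  ext ρ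
  exact hgt ρ ρ.2

/-- In a simplicial fan, the dual of the lattice generated by the ray generators of a cone is a
full-rank lattice. -/
theorem IsSimplicial.exists_isFundamentalSimplex [FiniteDimensional ℝ V] (hS : S.IsSimplicial)
    {σ : PointedCone ℝ V} (hσ : σ ∈ S.cones) :
    ∃ T, IsFundamentalSimplex (dualLattice (S.latticeOf σ)) T := by
  have hb : Set.range (Basis.span (hS.linearIndependent_gen hσ)) = Set.range (S.genIn σ) := by
    congr 1
    ext ρ
    rw [Basis.span_apply]
    rfl
  have h := exists_isFundamentalSimplex_dualLattice (Basis.span (hS.linearIndependent_gen hσ))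
  rw [hb] at h
  exact h

/-- The cones of a simplicial fan are generated by the generators of their rays. -/
theorem IsSimplicial.hull_gen_eq (hS : S.IsSimplicial) {σ : PointedCone ℝ V}
    (hσ : σ ∈ S.cones) :
    PointedCone.hull ℝ (Set.range fun ρ : S.raysOf σ => S.gen ρ) = σ := by
  obtain ⟨s, -, hs, -, h⟩ := hS.exists_generators hσ
  refine le_antisymm (Submodule.span_le.2 ?_) ?_
  · rintro _ ⟨ρ, rfl⟩
    have hface : ρ.1.1.IsFaceOf σ := by simpa [raysOf] using ρ.2
    refine hface.le ?_
    rw [← S.hull_gen ρ]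
    exact PointedCone.subset_hull rfl
  · nth_rewrite 1 [← hs]
    refine Submodule.span_le.2 fun y hy => ?_
    obtain ⟨ρ, hρ, t, ht, rfl⟩ := h y hy
    exact PointedCone.smul_mem _ ht.le (PointedCone.subset_hull ⟨⟨ρ, hρ⟩, rfl⟩)

/-- The polytopes of a simplicial fan are contained in the linear spans of their cones. -/
theorem IsSimplicial.polytope_subset (hS : S.IsSimplicial) {σ : PointedCone ℝ V}
    (hσ : σ ∈ S.cones) (z : S.Ray → ℝ) : S.polytope σ z ⊆ S.spanOf σ := by
  rintro v ⟨hv, -⟩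
  rw [← hS.hull_gen_eq hσ] at hv
  exact PointedCone.hull_le_span ℝ _ hv

/-- The polytopes of a simplicial fan are bounded. -/
theorem IsSimplicial.isBounded_polytope [FiniteDimensional ℝ V] (hS : S.IsSimplicial)
    {σ : PointedCone ℝ V} (hσ : σ ∈ S.cones) (z : S.Ray → ℝ) :
    Bornology.IsBounded (S.polytope σ z) := by
  classical
  have hli := hS.linearIndependent_gen hσ
  let b := Basis.extend hli.linearIndepOn_id
  have hsub := hli.linearIndepOn_id.subset_extend (Set.subset_univ _)
  let φ : S.raysOf σ → V →ₗ[ℝ] ℝ := fun ρ => b.coord ⟨S.gen ρ, hsub ⟨ρ, rfl⟩⟩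
  have hφ : ∀ ρ η : S.raysOf σ, φ ρ (S.gen η) = if η = ρ then 1 else 0 := by
    intro ρ η
    have h1 : b ⟨S.gen η, hsub ⟨η, rfl⟩⟩ = S.gen η := Basis.extend_apply_self _ _
    have h2 : b.coord ⟨S.gen ρ, hsub ⟨ρ, rfl⟩⟩ (b ⟨S.gen η, hsub ⟨η, rfl⟩⟩) =
        if η = ρ then 1 else 0 := by
      rw [Basis.coord_apply, Basis.repr_self, Finsupp.single_apply]
      refine if_congr ?_ rfl rfl
      rw [Subtype.mk.injEq]
      exact hli.injective.eq_iff
    rwa [h1] at h2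
  let C : ℝ := ∑ ρ : S.raysOf σ, ‖LinearMap.toContinuousLinearMap (φ ρ)‖ * |z ρ|
  refine (Metric.isBounded_closedBall (x := (0 : V)) (r := C)).subset ?_
  rintro v ⟨hv, hz⟩
  rw [mem_closedBall_zero_iff]
  rw [← hS.hull_gen_eq hσ] at hv
  obtain ⟨a, rfl⟩ := (Submodule.mem_span_range_iff_exists_fun _).1 hv
  set v := ∑ ρ, a ρ • S.gen ρ with hvdef
  have ha : ∀ ρ, φ ρ v = (a ρ : ℝ) := by
    intro ρ
    have : v = ∑ ρ, (a ρ : ℝ) • S.gen ρ := rfl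
    rw [this, map_sum]
    simp only [map_smul, hφ, smul_eq_mul, mul_ite, mul_one, mul_zero]
    rw [Finset.sum_ite_eq' Finset.univ ρ, if_pos (Finset.mem_univ ρ)]
  have h1 : ‖v‖ * ‖v‖ ≤ C * ‖v‖ := by
    rw [← real_inner_self_eq_norm_mul_norm]
    have h2 : inner ℝ v v = ∑ ρ, (a ρ : ℝ) * inner ℝ v (S.gen ρ) := by
      have : v = ∑ ρ, (a ρ : ℝ) • S.gen ρ := rfl
      nth_rewrite 2 [this]
      rw [inner_sum]
      simp only [real_inner_smul_right]
    rw [h2, Finset.sum_mul]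
    refine Finset.sum_le_sum fun ρ _ => ?_
    calc (a ρ : ℝ) * inner ℝ v (S.gen ρ) ≤ (a ρ : ℝ) * |z ρ| :=
          mul_le_mul_of_nonneg_left ((hz ρ ρ.2).trans (le_abs_self _)) (a ρ).2
      _ ≤ (‖LinearMap.toContinuousLinearMap (φ ρ)‖ * ‖v‖) * |z ρ| := by
          refine mul_le_mul_of_nonneg_right ?_ (abs_nonneg _)
          rw [← ha ρ]
          exact (le_abs_self _).trans ((LinearMap.toContinuousLinearMap (φ ρ)).le_opNorm v)
      _ = _ := by ring
  by_cases hv0 : ‖v‖ = 0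
  · rw [hv0]
    exact Finset.sum_nonneg fun ρ _ => by positivity
  · exact le_of_mul_le_mul_right h1 (lt_of_le_of_ne (norm_nonneg v) (Ne.symm hv0))

end WellDefined

end MarkedFan

end

/-!
The truncated cone `P = {v ∈ σ | v * u_ρ ≤ z_ρ}` is triangulated by simplices indexed by the
enumerations `f` of the rays of `σ`, and the formula is the sum of their volumes.

For a set `B` of rays of `σ`, let `w B` be the point of the face spanned by `B` with
`w B * u_ρ = z_ρ` for all `ρ ∈ B`; it exists because `z` is pseudo-cubical
(`MarkedFan.IsPseudoCubical.exists_isVertexSystem`), and it satisfies all the other inequalities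
(`IsVertexSystem.inner_le`). The simplex of `f` is the convex hull of the points `w B` for the
initial sets `B` of `f`.

* The simplices cover `P` (`IsVertexSystem.truncatedCone_eq_iUnion`): push a point of `P` away from
  `w ∅ = 0` until it hits a hyperplane `v * u_ρ = z_ρ`, then push it away from `w {ρ}` inside that
  hyperplane, and so on. The rays that are met in this process form the enumeration.
* The simplices overlap in null sets (`IsVertexSystem.aedisjoint_chainSimplex`): suppose that `f`
  and `g` have the common initial set `B` and continue with different rays `r` and `s`. The
  component `q` of `(z_s - w B * u_s) u_r - (z_r - w B * u_r) u_s` orthogonal to the face of `B` is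
  nonnegative on the simplex of `f` and nonpositive on that of `g`. If `q ≠ 0`, the intersection
  lies in a hyperplane; if `q = 0`, two consecutive vertices of the simplex of `f` coincide.
* In the basis of the ray generators, ordered by `f`, the vertices of the simplex form a triangular
  matrix (`IsVertexSystem.addHaar_chainSimplex`), whose diagonal entries are the quotients of Gram
  determinants in the formula, by Cramer's rule (`IsVertexSystem.repr_eq_det_div_det`).
* The simplex spanned by the ray generators has normalized volume `det G_σ`, since `G_σ` expresses
  the ray generators in the dual basis, a basis of the dual lattice
  (`latticeVolume_convexHull_basis`).
-/

/-! ### Vertices of a truncated simplicial cone -/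

section VertexSystem

variable {ι E : Type*} [NormedAddCommGroup E] [InnerProductSpace ℝ E]

/-- The cone spanned by the basis `u`, truncated by the half-spaces `v * u i ≤ z i`; membership in
the cone is expressed by nonnegativity of the coordinates. -/
def truncatedCone (u : Basis ι ℝ E) (z : ι → ℝ) : Set E :=
  {v | (∀ i, 0 ≤ u.repr v i) ∧ ∀ i, inner ℝ v (u i) ≤ z i}

theorem convex_truncatedCone (u : Basis ι ℝ E) (z : ι → ℝ) :
    Convex ℝ (truncatedCone u z) := by
  intro x hx y hy a b ha hb hab
  refine ⟨fun i => ?_, fun i => ?_⟩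
  · simpa using add_nonneg (mul_nonneg ha (hx.1 i)) (mul_nonneg hb (hy.1 i))
  · rw [inner_add_left, real_inner_smul_left, real_inner_smul_left]
    calc a * inner ℝ x (u i) + b * inner ℝ y (u i) ≤ a * z i + b * z i :=
          add_le_add (mul_le_mul_of_nonneg_left (hx.2 i) ha) (mul_le_mul_of_nonneg_left (hy.2 i) hb)
      _ = z i := by rw [← add_mul, hab, one_mul]

/-- `w B` is, for every set `B` of indices, a point of the face of the cone of `u` spanned by
`B` at which the inequalities `v * u i ≤ z i` for `i ∈ B` are equalities. -/
structure IsVertexSystem (u : Basis ι ℝ E) (z : ι → ℝ) (w : Finset ι → E) : Prop where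
  repr_nonneg : ∀ B i, 0 ≤ u.repr (w B) i
  repr_eq_zero : ∀ B i, i ∉ B → u.repr (w B) i = 0
  inner_eq : ∀ B, ∀ i ∈ B, inner ℝ (w B) (u i) = z i

theorem Module.Basis.repr_eq_zero_of_mem_span_image (u : Basis ι ℝ E) {B : Finset ι} {x : E}
    (hx : x ∈ Submodule.span ℝ (u '' B)) {i : ι} (hi : i ∉ B) : u.repr x i = 0 := by
  by_contra hne
  exact hi (u.mem_span_image.1 hx (Finsupp.mem_support_iff.2 hne))

theorem Module.Basis.mem_span_image_of_repr_eq_zero (u : Basis ι ℝ E) {B : Finset ι} {x : E}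
    (hx : ∀ i, i ∉ B → u.repr x i = 0) : x ∈ Submodule.span ℝ (u '' B) :=
  u.mem_span_image.2 fun i hi => by
    by_contra hne
    exact Finsupp.mem_support_iff.1 hi (hx i hne)

variable [Fintype ι]

theorem inner_eq_sum_repr (u : Basis ι ℝ E) (x y : E) :
    inner ℝ x y = ∑ i, u.repr y i * inner ℝ x (u i) := by
  conv_lhs => rw [← u.sum_repr y]
  simp only [inner_sum, real_inner_smul_right]

theorem inner_eq_zero_of_repr_of_inner (u : Basis ι ℝ E) {B : Finset ι} {x y : E}
    (h0 : ∀ i, i ∉ B → u.repr y i = 0) (h1 : ∀ i ∈ B, inner ℝ x (u i) = 0) :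
    inner ℝ x y = 0 := by
  rw [inner_eq_sum_repr u]
  refine Finset.sum_eq_zero fun i _ => ?_
  by_cases hi : i ∈ B
  · rw [h1 i hi, mul_zero]
  · rw [h0 i hi, zero_mul]

/-- The Gram matrix of each subfamily of a basis is nondegenerate. -/
theorem eq_zero_of_repr_of_inner (u : Basis ι ℝ E) {B : Finset ι} {x : E}
    (h0 : ∀ i, i ∉ B → u.repr x i = 0) (h1 : ∀ i ∈ B, inner ℝ x (u i) = 0) : x = 0 :=
  inner_self_eq_zero.1 (inner_eq_zero_of_repr_of_inner u h0 h1)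

namespace IsVertexSystem

variable {u : Basis ι ℝ E} {z : ι → ℝ} {w : Finset ι → E}

theorem eq_of_repr_of_inner (h : IsVertexSystem u z w) {B : Finset ι} {x : E}
    (h0 : ∀ i, i ∉ B → u.repr x i = 0) (h1 : ∀ i ∈ B, inner ℝ x (u i) = z i) : x = w B := by
  refine sub_eq_zero.1 (eq_zero_of_repr_of_inner u (B := B) (fun i hi => ?_) fun i hi => ?_)
  · simp [h0 i hi, h.repr_eq_zero B i hi]
  · rw [inner_sub_left, h1 i hi, h.inner_eq B i hi, sub_self]

/-- The points `w B` satisfy all the inequalities: adding an index `i` to `B` moves `w B` by a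
nonnegative multiple of the component of `u i` orthogonal to the face spanned by `B`. -/
theorem inner_le [DecidableEq ι] (h : IsVertexSystem u z w) (B : Finset ι) (i : ι) :
    inner ℝ (w B) (u i) ≤ z i := by
  by_cases hi : i ∈ B
  · exact (h.inner_eq B i hi).le
  set d := w (insert i B) - w B with hd
  have hdB : ∀ j ∈ B, inner ℝ d (u j) = 0 := fun j hj => by
    rw [hd, inner_sub_left, h.inner_eq _ j (Finset.mem_insert_of_mem hj), h.inner_eq B j hj,
      sub_self]
  have hdi : u.repr d i = u.repr (w (insert i B)) i := by
    simp [hd, h.repr_eq_zero B i hi]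
  have hdd : inner ℝ d d = u.repr d i * inner ℝ d (u i) := by
    rw [inner_eq_sum_repr u, Finset.sum_eq_single i _ (by simp)]
    intro j _ hj
    by_cases hjB : j ∈ B
    · rw [hdB j hjB, mul_zero]
    · have : u.repr d j = 0 := by
        simp [hd, h.repr_eq_zero B j hjB, h.repr_eq_zero (insert i B) j (by simp [hj, hjB])]
      rw [this, zero_mul]
  have hi' : inner ℝ d (u i) = z i - inner ℝ (w B) (u i) := by
    rw [hd, inner_sub_left, h.inner_eq _ i (Finset.mem_insert_self i B)]
  have hnn : 0 ≤ inner ℝ d (u i) := by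
    rcases (h.repr_nonneg (insert i B) i).eq_or_lt with h0 | h0
    · rw [hdi, ← h0, zero_mul, inner_self_eq_zero] at hdd
      rw [hdd, inner_zero_left]
    · rw [← hdi] at h0
      exact nonneg_of_mul_nonneg_right (hdd ▸ real_inner_self_nonneg) h0
  linarith

theorem mem_truncatedCone [DecidableEq ι] (h : IsVertexSystem u z w) (B : Finset ι) :
    w B ∈ truncatedCone u z :=
  ⟨h.repr_nonneg B, h.inner_le B⟩

theorem empty_eq_zero (h : IsVertexSystem u z w) : w ∅ = 0 :=
  (h.eq_of_repr_of_inner (by simp) (by simp)).symm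

/-- A point of the truncated cone lying on the hyperplanes indexed by `B` can be pushed away from
`w B` until it hits a further hyperplane. The sign conditions are imposed only on the
coordinates outside `B`, which are scaled by a positive factor in this process. -/
theorem exists_mem_segment [DecidableEq ι] (h : IsVertexSystem u z w) {B : Finset ι}
    (hB : B ≠ Finset.univ) {p : E}
    (hp0 : ∀ i, i ∉ B → 0 ≤ u.repr p i) (hpe : ∀ i ∈ B, inner ℝ p (u i) = z i)
    (hple : ∀ i, inner ℝ p (u i) ≤ z i) :
    ∃ r, r ∉ B ∧ ∃ q, p ∈ segment ℝ (w B) q ∧ (∀ i, i ∉ insert r B → 0 ≤ u.repr q i) ∧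
      (∀ i ∈ insert r B, inner ℝ q (u i) = z i) ∧ ∀ i, inner ℝ q (u i) ≤ z i := by
  by_cases hpB : p = w B
  · obtain ⟨r, hr⟩ : ∃ r, r ∉ B := by
      by_contra! hcon
      exact hB (Finset.eq_univ_iff_forall.2 hcon)
    exact ⟨r, hr, w (insert r B), hpB ▸ left_mem_segment ℝ _ _, fun i _ => h.repr_nonneg _ i,
      h.inner_eq _, h.inner_le _⟩
  set d := p - w B with hd
  have hd0 : d ≠ 0 := sub_ne_zero.2 hpB
  have hdB : ∀ i ∈ B, inner ℝ d (u i) = 0 := fun i hi => by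
    rw [hd, inner_sub_left, hpe i hi, h.inner_eq B i hi, sub_self]
  have hdr : ∀ i, i ∉ B → 0 ≤ u.repr d i := fun i hi => by
    simpa [hd, h.repr_eq_zero B i hi] using hp0 i hi
  let T : Finset ι := Finset.univ.filter fun i => 0 < inner ℝ d (u i)
  have hT : T.Nonempty := by
    by_contra hcon
    have hneg : ∀ i, inner ℝ d (u i) ≤ 0 := fun i => by
      by_contra hi
      exact hcon ⟨i, by simpa [T] using hi⟩
    refine hd0 (real_inner_self_nonpos.1 ?_)
    rw [inner_eq_sum_repr u]
    refine Finset.sum_nonpos fun i _ => ?_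
    by_cases hi : i ∈ B
    · rw [hdB i hi, mul_zero]
    · exact mul_nonpos_of_nonneg_of_nonpos (hdr i hi) (hneg i)
  obtain ⟨r, hrT, hmin⟩ := T.exists_min_image
    (fun i => (z i - inner ℝ (w B) (u i)) / inner ℝ d (u i)) hT
  have hr : 0 < inner ℝ d (u r) := by simpa [T] using hrT
  have hrB : r ∉ B := fun hrB => hr.ne' (hdB r hrB)
  -- `t` is the largest factor for which `w B + t • d` satisfies all the inequalities.
  set t := (z r - inner ℝ (w B) (u r)) / inner ℝ d (u r) with ht
  have hpd : ∀ i, inner ℝ p (u i) = inner ℝ (w B) (u i) + inner ℝ d (u i) := fun i => by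
    rw [hd, inner_sub_left]; ring
  have ht1 : 1 ≤ t := by
    rw [ht, one_le_div hr]
    linarith [hple r, hpd r]
  have hq : ∀ i, inner ℝ (w B + t • d) (u i) = inner ℝ (w B) (u i) + t * inner ℝ d (u i) :=
    fun i => by rw [inner_add_left, real_inner_smul_left]
  refine ⟨r, hrB, w B + t • d, ?_, fun i hi => ?_, fun i hi => ?_, fun i => ?_⟩
  · refine ⟨1 - t⁻¹, t⁻¹, sub_nonneg.2 (inv_le_one_of_one_le₀ ht1), by positivity, by ring, ?_⟩
    have ht0 : t ≠ 0 := by positivity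
    rw [smul_add, inv_smul_smul₀ ht0, sub_smul, one_smul, hd]
    abel
  · have hiB : i ∉ B := fun hiB => hi (Finset.mem_insert_of_mem hiB)
    have : u.repr (w B + t • d) i = t * u.repr d i := by
      simp [h.repr_eq_zero B i hiB]
    rw [this]
    exact mul_nonneg (by positivity) (hdr i hiB)
  · rw [hq]
    rcases Finset.mem_insert.1 hi with rfl | hiB
    · rw [ht, div_mul_cancel₀ _ hr.ne']; ring
    · rw [hdB i hiB, h.inner_eq B i hiB, mul_zero, add_zero]
  · rw [hq]
    rcases le_or_gt (inner ℝ d (u i)) 0 with hi | hi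
    · nlinarith [h.inner_le B i, mul_nonneg (zero_le_one.trans ht1) (neg_nonneg.2 hi)]
    · have := hmin i (by simpa [T] using hi)
      rw [le_div_iff₀ hi] at this
      linarith

/-- The coordinates of the vertices are given by Cramer's rule. -/
theorem repr_eq_det_div_det [DecidableEq ι] (h : IsVertexSystem u z w) (B : Finset ι) (r : B) :
    u.repr (w B) r =
      ((gram ℝ fun i : B => u i).updateCol r fun i => z i).det / (gram ℝ fun i : B => u i).det := by
  have hpos : 0 < (gram ℝ fun i : B => u i).det :=
    (posDef_gram_of_linearIndependent
      (u.linearIndependent.comp _ Subtype.val_injective)).det_pos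
  have hmul : gram ℝ (fun i : B => u i) *ᵥ (fun i : B => u.repr (w B) i) = fun i : B => z i := by
    ext i
    rw [← h.inner_eq B i i.2, real_inner_comm, inner_eq_sum_repr u, mulVec, dotProduct,
      ← Finset.sum_subset (Finset.subset_univ B)
        fun j _ hj => by rw [h.repr_eq_zero B j hj, zero_mul], ← Finset.sum_coe_sort B]
    exact Finset.sum_congr rfl fun j _ => mul_comm _ _
  rw [eq_div_iff hpos.ne', ← cramer_apply, ← hmul, cramer_eq_adjugate_mulVec, mulVec_mulVec,
    adjugate_mul, smul_mulVec, one_mulVec, Pi.smul_apply, smul_eq_mul, mul_comm]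

end IsVertexSystem

/-! ### The simplices attached to enumerations of the index set -/

variable {k : ℕ}

/-- The set of the first `n` indices in the enumeration `f`. -/
def initialIndices (f : Fin k ≃ ι) (n : ℕ) : Finset ι :=
  Finset.univ.filter fun i => (f.symm i : ℕ) < n

@[simp]
theorem mem_initialIndices {f : Fin k ≃ ι} {n : ℕ} {i : ι} :
    i ∈ initialIndices f n ↔ (f.symm i : ℕ) < n := by
  simp [initialIndices]

/-- The convex hull of the points attached to the chain of initial index sets of `f`. -/
def chainSimplex (w : Finset ι → E) (f : Fin k ≃ ι) : Set E :=
  convexHull ℝ ((fun n => w (initialIndices f n)) '' Set.Iic k)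

theorem isCompact_chainSimplex (w : Finset ι → E) (f : Fin k ≃ ι) :
    IsCompact (chainSimplex w f) :=
  Set.Finite.isCompact_convexHull ℝ ((Set.finite_Iic k).image _)

namespace IsVertexSystem

variable {u : Basis ι ℝ E} {z : ι → ℝ} {w : Finset ι → E}

theorem chainSimplex_subset [DecidableEq ι] (h : IsVertexSystem u z w) (f : Fin k ≃ ι) :
    chainSimplex w f ⊆ truncatedCone u z := by
  refine convexHull_min ?_ (convex_truncatedCone u z)
  rintro _ ⟨n, -, rfl⟩
  exact h.mem_truncatedCone _

theorem chainSimplex_eq (h : IsVertexSystem u z w) (f : Fin k ≃ ι) :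
    chainSimplex w f = convexHull ℝ
      (insert 0 (Set.range fun j : Fin k => w (initialIndices f (j + 1)))) := by
  rw [chainSimplex]
  congr 1
  ext x
  constructor
  · rintro ⟨n, hn, rfl⟩
    rcases n with _ | n
    · left
      have : initialIndices f 0 = ∅ := by ext; simp
      simp only [this, h.empty_eq_zero]
    · exact Or.inr ⟨⟨n, hn⟩, rfl⟩
  · rintro (rfl | ⟨j, rfl⟩)
    · refine ⟨0, Nat.zero_le k, ?_⟩
      have : initialIndices f 0 = ∅ := by ext; simp
      simp only [this, h.empty_eq_zero]
    · exact ⟨j + 1, j.2, rfl⟩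

/-- Every point of the truncated cone on the hyperplanes indexed by the first `n` indices of `f`
lies in a simplex whose enumeration agrees with `f` on these indices. -/
theorem exists_mem_convexHull [DecidableEq ι] (h : IsVertexSystem u z w) {n : ℕ}
    (hn : n ≤ k) (f : Fin k ≃ ι) {p : E} (hp0 : ∀ i, i ∉ initialIndices f n → 0 ≤ u.repr p i)
    (hpe : ∀ i ∈ initialIndices f n, inner ℝ p (u i) = z i)
    (hple : ∀ i, inner ℝ p (u i) ≤ z i) :
    ∃ g : Fin k ≃ ι, (∀ m ≤ n, initialIndices g m = initialIndices f m) ∧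
      p ∈ convexHull ℝ ((fun m => w (initialIndices g m)) '' Set.Icc n k) := by
  induction hd : k - n generalizing n f p with
  | zero =>
    obtain rfl : n = k := by omega
    refine ⟨f, fun _ _ => rfl, subset_convexHull ℝ _ ⟨n, by simp, ?_⟩⟩
    exact (h.eq_of_repr_of_inner (fun i hi => absurd (by simp) hi) hpe).symm
  | succ d ih =>
    have hnk : n < k := by omega
    have hne : initialIndices f n ≠ Finset.univ := fun hcon => by
      have : f ⟨n, hnk⟩ ∈ initialIndices f n := hcon ▸ Finset.mem_univ _
      simp at this
    obtain ⟨r, hr, q, hseg, hq0, hqe, hqle⟩ := h.exists_mem_segment hne hp0 hpe hple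
    -- Interchange `r` with the index at position `n`.
    let f' : Fin k ≃ ι := (Equiv.swap (f.symm r) ⟨n, hnk⟩).trans f
    have hsymm : ∀ i, f'.symm i = Equiv.swap (f.symm r) ⟨n, hnk⟩ (f.symm i) := fun i => rfl
    have hrn : n ≤ (f.symm r : ℕ) := by simpa using hr
    -- The positions of `i` in `f` and `f'`: the interchange takes place among positions `≥ n`.
    have hpos : ∀ i, (i = r ∧ (f'.symm i : ℕ) = n) ∨
        (i ≠ r ∧ (f.symm i : ℕ) < n ∧ f'.symm i = f.symm i) ∨
        (i ≠ r ∧ n ≤ (f.symm i : ℕ) ∧ n < (f'.symm i : ℕ)) := by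
      intro i
      rw [hsymm]
      by_cases hir : i = r
      · left; subst hir; simp
      have hne' : f.symm i ≠ f.symm r := fun hcon => hir (f.symm.injective hcon)
      have hne'' := Fin.val_ne_of_ne hne'
      by_cases hin : f.symm i = ⟨n, hnk⟩
      · right; right
        have : (f.symm i : ℕ) = n := by rw [hin]
        rw [hin, Equiv.swap_apply_right]
        exact ⟨hir, le_refl _, by omega⟩
      · have := Fin.val_ne_of_ne hin
        rw [Equiv.swap_apply_of_ne_of_ne hne' hin]
        simp only at this
        by_cases hlt : (f.symm i : ℕ) < n
        · exact Or.inr (Or.inl ⟨hir, hlt, rfl⟩)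
        · exact Or.inr (Or.inr ⟨hir, by omega, by omega⟩)
    have hinit : ∀ m ≤ n, initialIndices f' m = initialIndices f m := by
      intro m hm
      ext i
      rw [mem_initialIndices, mem_initialIndices]
      rcases hpos i with ⟨rfl, h1⟩ | ⟨h1, h2, h3⟩ | ⟨h1, h2, h3⟩
      · omega
      · rw [h3]
      · omega
    have hinit' : initialIndices f' (n + 1) = insert r (initialIndices f n) := by
      ext i
      rw [mem_initialIndices, Finset.mem_insert, mem_initialIndices]
      rcases hpos i with ⟨rfl, h1⟩ | ⟨h1, h2, h3⟩ | ⟨h1, h2, h3⟩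
      · simp [h1]
      · simp only [h3, h1, false_or]; omega
      · simp only [h1, false_or]; omega
    obtain ⟨g, hg, hqg⟩ := ih (n := n + 1) (by omega) f' (by rwa [hinit']) (by rwa [hinit']) hqle
      (by omega)
    have hgn : initialIndices g n = initialIndices f n := (hg n (by omega)).trans (hinit n le_rfl)
    refine ⟨g, fun m hm => (hg m (by omega)).trans (hinit m hm), ?_⟩
    have hw : w (initialIndices f n) ∈
        convexHull ℝ ((fun m => w (initialIndices g m)) '' Set.Icc n k) := by
      rw [← hgn]
      exact subset_convexHull ℝ _ ⟨n, ⟨le_rfl, hn⟩, rfl⟩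
    exact (convex_convexHull ℝ _).segment_subset hw
      (convexHull_mono (Set.image_mono (Set.Icc_subset_Icc_left n.le_succ)) hqg) hseg

theorem truncatedCone_eq_iUnion [DecidableEq ι] (h : IsVertexSystem u z w)
    (hk : Nonempty (Fin k ≃ ι)) :
    truncatedCone u z = ⋃ f : Fin k ≃ ι, chainSimplex w f := by
  refine subset_antisymm (fun p hp => ?_) (Set.iUnion_subset h.chainSimplex_subset)
  obtain ⟨g, -, hg⟩ := h.exists_mem_convexHull (Nat.zero_le k) hk.some (fun i _ => hp.1 i)
    (fun i hi => by simp at hi) hp.2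
  exact Set.mem_iUnion.2 ⟨g, convexHull_mono (Set.image_mono fun _ hm => hm.2) hg⟩

end IsVertexSystem

end VertexSystem

section SimplexVolume

variable {ι E : Type*} [NormedAddCommGroup E] [InnerProductSpace ℝ E]
  {u : Basis ι ℝ E} {z : ι → ℝ} {w : Finset ι → E} {k : ℕ}

/-! ### Separation of two simplices -/

namespace IsVertexSystem

/-- The normal vector of a hyperplane through the origin that separates the simplices of two
enumerations which have `B` as a common initial set and continue with `r` and with `s`: the
component orthogonal to the face spanned by `B` of a combination of `u r` and `u s`. -/
noncomputable def separatingNormal [FiniteDimensional ℝ E] (u : Basis ι ℝ E) (z : ι → ℝ) (w : Finset ι → E)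
    (B : Finset ι) (r s : ι) : E :=
  let q := (z s - inner ℝ (w B) (u s)) • u r - (z r - inner ℝ (w B) (u r)) • u s
  q - (Submodule.span ℝ (u '' B)).starProjection q

variable [FiniteDimensional ℝ E]

theorem separatingNormal_swap (B : Finset ι) (r s : ι) :
    separatingNormal u z w B s r = -separatingNormal u z w B r s := by
  simp only [separatingNormal, map_sub]
  abel

theorem eq_inner_of_separatingNormal_eq_zero {B : Finset ι} {r s : ι} (hrs : r ≠ s) (hs : s ∉ B)
    (h0 : separatingNormal u z w B r s = 0) : inner ℝ (w B) (u r) = z r := by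
  -- The coordinate of `separatingNormal u z w B r s` at `s` is `inner ℝ (w B) (u r) - z r`.
  have h1 := congrArg (fun x => u.repr x s) h0
  simp only [separatingNormal, map_sub, Finsupp.sub_apply, map_zero, Finsupp.coe_zero,
    Pi.zero_apply] at h1
  rw [u.repr_eq_zero_of_mem_span_image (Submodule.starProjection_apply_mem _ _) hs,
    u.repr_eq_zero_of_mem_span_image (Submodule.starProjection_apply_mem _ _) hs] at h1
  simp [hrs] at h1
  linarith

theorem inner_separatingNormal_of_subset (h : IsVertexSystem u z w) {A B : Finset ι} (hAB : A ⊆ B)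
    (r s : ι) : inner ℝ (w A) (separatingNormal u z w B r s) = 0 := by
  refine (real_inner_comm _ _).trans (Submodule.starProjection_inner_eq_zero _ _ ?_)
  exact u.mem_span_image_of_repr_eq_zero fun i hi =>
    h.repr_eq_zero A i fun hA => hi (hAB hA)

variable [Fintype ι]

theorem inner_separatingNormal_nonneg [DecidableEq ι] (h : IsVertexSystem u z w) {B C : Finset ι}
    (hBC : B ⊆ C) {r : ι} (hr : r ∈ C) (s : ι) :
    0 ≤ inner ℝ (w C) (separatingNormal u z w B r s) := by
  have hort : ∀ x ∈ Submodule.span ℝ (u '' B), inner ℝ (w C - w B) x = 0 := fun x hx =>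
    inner_eq_zero_of_repr_of_inner u
      (fun i hi => u.repr_eq_zero_of_mem_span_image hx hi) fun i hi => by
        rw [inner_sub_left, h.inner_eq C i (hBC hi), h.inner_eq B i hi, sub_self]
  have h1 : inner ℝ (w C) (separatingNormal u z w B r s) =
      inner ℝ (w C - w B) (separatingNormal u z w B r s) := by
    rw [inner_sub_left, h.inner_separatingNormal_of_subset subset_rfl, sub_zero]
  rw [h1, separatingNormal, inner_sub_right, hort _ (Submodule.starProjection_apply_mem _ _),
    sub_zero, inner_sub_right, real_inner_smul_right, real_inner_smul_right, inner_sub_left,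
    inner_sub_left, h.inner_eq C r hr]
  -- The inner product equals `(z r - w B * u r) * (z s - w C * u s)`.
  nlinarith [mul_nonneg (sub_nonneg.2 (h.inner_le B r)) (sub_nonneg.2 (h.inner_le C s))]

/-- The simplex of `f` lies in the half-space attached to any initial set of `f`, the index
following it, and any further index. -/
theorem inner_separatingNormal_nonneg_of_mem [DecidableEq ι] (h : IsVertexSystem u z w)
    (f : Fin k ≃ ι) (n : Fin k) (s : ι) {x : E} (hx : x ∈ chainSimplex w f) :
    0 ≤ inner ℝ x (separatingNormal u z w (initialIndices f n) (f n) s) := by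
  have hconv : Convex ℝ {x : E |
      0 ≤ inner ℝ x (separatingNormal u z w (initialIndices f n) (f n) s)} := by
    simp_rw [fun x => real_inner_comm (separatingNormal u z w (initialIndices f n) (f n) s) x]
    exact convex_halfSpace_ge (innerₗ E _).isLinear 0
  refine convexHull_min ?_ hconv hx
  rintro _ ⟨m, -, rfl⟩
  rcases le_or_gt m n with hm | hm
  · refine (h.inner_separatingNormal_of_subset (fun i hi => ?_) _ _).ge
    rw [mem_initialIndices] at hi ⊢
    omega
  · refine h.inner_separatingNormal_nonneg (fun i hi => ?_) (by simpa using hm) s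
    rw [mem_initialIndices] at hi ⊢
    omega

end IsVertexSystem

/-! ### The volume of the truncated cone -/

variable [Fintype ι] [FiniteDimensional ℝ E] [MeasurableSpace E] [BorelSpace E] (μ : Measure E)
  [μ.IsAddHaarMeasure]

/-- The volume of a simplex with a vertex at the origin, relative to that of the simplex
spanned by a basis. -/
theorem addHaar_convexHull_insert_zero {κ : Type*} [Fintype κ] [DecidableEq κ] (b : Basis κ ℝ E)
    (v : κ → E) : μ (convexHull ℝ (insert 0 (Set.range v))) =
      ENNReal.ofReal |b.det v| * μ (convexHull ℝ (insert 0 (Set.range b))) := by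
  have himg : convexHull ℝ (insert 0 (Set.range v)) =
      b.constr ℝ v '' convexHull ℝ (insert 0 (Set.range b)) := by
    rw [LinearMap.image_convexHull, Set.image_insert_eq, map_zero, ← Set.range_comp]
    congr 3
    ext i
    simp
  have hdet : LinearMap.det (b.constr ℝ v) = b.det v := by
    rw [← LinearMap.det_toMatrix b, Basis.det_apply]
    congr 1
    ext i j
    simp [LinearMap.toMatrix_apply, Basis.toMatrix_apply]
  rw [himg, Measure.addHaar_image_linearMap, hdet]

namespace IsVertexSystem

/-- The matrix of the vertices of a chain simplex is triangular. -/
theorem addHaar_chainSimplex (h : IsVertexSystem u z w) (f : Fin k ≃ ι) :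
    μ (chainSimplex w f) = ENNReal.ofReal (∏ j : Fin k, u.repr (w (initialIndices f (j + 1))) (f j)) *
      μ (convexHull ℝ (insert 0 (Set.range u))) := by
  have hdet : (u.reindex f.symm).det (fun j : Fin k => w (initialIndices f (j + 1))) =
      ∏ j : Fin k, u.repr (w (initialIndices f (j + 1))) (f j) := by
    rw [Basis.det_apply, det_of_isUpperTriangular]
    · simp [Basis.toMatrix_apply]
    · intro i j hij
      rw [Basis.toMatrix_apply, Basis.repr_reindex_apply]
      refine h.repr_eq_zero _ _ ?_
      simp only [id] at hij
      simp only [Equiv.symm_symm, mem_initialIndices, Equiv.symm_apply_apply]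
      omega
  rw [h.chainSimplex_eq, addHaar_convexHull_insert_zero μ (u.reindex f.symm), hdet,
    Basis.range_reindex, abs_of_nonneg (Finset.prod_nonneg fun j _ => h.repr_nonneg _ _)]

/-- If two consecutive vertices of a chain simplex coincide, it is a null set. -/
theorem addHaar_chainSimplex_eq_zero (h : IsVertexSystem u z w) (f : Fin k ≃ ι) (n : Fin k)
    (hn : inner ℝ (w (initialIndices f n)) (u (f n)) = z (f n)) : μ (chainSimplex w f) = 0 := by
  have hw : w (initialIndices f n) = w (initialIndices f (n + 1)) := by
    refine h.eq_of_repr_of_inner (fun i hi => h.repr_eq_zero _ i ?_) fun i hi => ?_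
    · rw [mem_initialIndices] at hi ⊢
      omega
    · rw [mem_initialIndices] at hi
      rcases Nat.lt_succ_iff_lt_or_eq.1 hi with hi | hi
      · exact h.inner_eq _ i (mem_initialIndices.2 hi)
      · obtain rfl : f n = i := by rw [← Fin.ext hi, Equiv.apply_symm_apply]
        exact hn
  have h0 : ∏ j : Fin k, u.repr (w (initialIndices f (j + 1))) (f j) = 0 :=
    Finset.prod_eq_zero (Finset.mem_univ n) (by
      rw [← hw]
      exact h.repr_eq_zero _ _ (by simp))
  rw [h.addHaar_chainSimplex μ, h0, ENNReal.ofReal_zero, zero_mul]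

theorem _root_.addHaar_setOf_inner_eq_zero {q : E} (hq : q ≠ 0) :
    μ {x : E | inner ℝ x q = 0} = 0 := by
  have h1 : {x : E | inner ℝ x q = 0} = ((innerₗ E q).ker : Set E) := by
    ext x
    simp [real_inner_comm]
  rw [h1]
  refine Measure.addHaar_submodule μ _ fun htop => hq ?_
  have h2 : q ∈ (innerₗ E q).ker := htop ▸ Submodule.mem_top
  simpa using h2

theorem aedisjoint_chainSimplex [DecidableEq ι] (h : IsVertexSystem u z w) {f g : Fin k ≃ ι}
    (hfg : f ≠ g) : AEDisjoint μ (chainSimplex w f) (chainSimplex w g) := by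
  -- `n` is the first position at which `f` and `g` differ.
  obtain ⟨n, hn, hmin⟩ : ∃ n, f n ≠ g n ∧ ∀ m < n, f m = g m := by
    have hne : (Finset.univ.filter fun n => f n ≠ g n).Nonempty := by
      by_contra hcon
      refine hfg (Equiv.ext fun n => ?_)
      by_contra hn
      exact hcon ⟨n, by simpa using hn⟩
    refine ⟨Finset.min' _ hne, by simpa using Finset.min'_mem _ hne, fun m hm => ?_⟩
    by_contra hcon
    exact (Finset.min'_le _ m (by simpa using hcon)).not_gt hm
  have hinit : initialIndices f n = initialIndices g n := by
    ext i
    rw [mem_initialIndices, mem_initialIndices]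
    refine ⟨fun hi => ?_, fun hi => ?_⟩
    · have := hmin (f.symm i) hi
      rw [Equiv.apply_symm_apply] at this
      rwa [this, Equiv.symm_apply_apply]
    · have := hmin (g.symm i) hi
      rw [Equiv.apply_symm_apply] at this
      rwa [← this, Equiv.symm_apply_apply]
  set q := separatingNormal u z w (initialIndices f n) (f n) (g n) with hq
  by_cases hq0 : q = 0
  · have hg : g n ∉ initialIndices f n := by rw [hinit]; simp
    exact AEDisjoint.of_null_left (h.addHaar_chainSimplex_eq_zero μ f n
      (eq_inner_of_separatingNormal_eq_zero hn hg hq0))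
  · refine measure_mono_null (fun x hx => ?_) (addHaar_setOf_inner_eq_zero μ hq0)
    have h1 := h.inner_separatingNormal_nonneg_of_mem f n (g n) hx.1
    have h2 := h.inner_separatingNormal_nonneg_of_mem g n (f n) hx.2
    rw [← hinit, separatingNormal_swap, inner_neg_right] at h2
    exact le_antisymm (by linarith) h1

theorem addHaar_truncatedCone [DecidableEq ι] (h : IsVertexSystem u z w)
    (hk : Nonempty (Fin k ≃ ι)) :
    μ (truncatedCone u z) =
      ENNReal.ofReal (∑ f : Fin k ≃ ι, ∏ j : Fin k, u.repr (w (initialIndices f (j + 1))) (f j)) *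
        μ (convexHull ℝ (insert 0 (Set.range u))) := by
  rw [h.truncatedCone_eq_iUnion hk, measure_iUnion₀
    (fun f g hfg => h.aedisjoint_chainSimplex μ hfg)
    fun f => (isCompact_chainSimplex w f).measurableSet.nullMeasurableSet, tsum_fintype,
    ENNReal.ofReal_sum_of_nonneg fun f _ => Finset.prod_nonneg fun j _ => h.repr_nonneg _ _,
    Finset.sum_mul]
  exact Finset.sum_congr rfl fun f _ => h.addHaar_chainSimplex μ f

end IsVertexSystem

/-- The matrix expressing a basis `u` in the dual basis is the Gram matrix of `u`, so the simplex
spanned by `u` has volume `det (gram ℝ u)`. -/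
theorem latticeVolume_convexHull_basis [DecidableEq ι] (u : Basis ι ℝ E) :
    latticeVolume (dualLattice (Submodule.span ℤ (Set.range u)))
      (convexHull ℝ (insert 0 (Set.range u))) = ENNReal.ofReal (gram ℝ u).det := by
  have hB : LinearMap.BilinForm.Nondegenerate (innerₗ E) :=
    ⟨fun x hx => inner_self_eq_zero.1 (hx x), fun y hy => inner_self_eq_zero.1 (hy y)⟩
  let b := LinearMap.BilinForm.dualBasis (innerₗ E) hB u
  have hT : IsFundamentalSimplex (dualLattice (Submodule.span ℤ (Set.range u)))
      (convexHull ℝ (insert 0 (Set.range b))) := by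
    let e : ι ≃ Fin (finrank ℝ E) := Fintype.equivFinOfCardEq (finrank_eq_card_basis u).symm
    refine ⟨b.reindex e, ?_, by rw [Basis.range_reindex]⟩
    rw [Basis.range_reindex, dualLattice, LinearMap.BilinForm.dualSubmodule_span_of_basis _ hB]
  have := isAddHaarMeasure_latticeVolume hT
  have hdet : b.det u = (gram ℝ u).det := by
    rw [Basis.det_apply]
    congr 1
    ext i j
    rw [Basis.toMatrix_apply, LinearMap.BilinForm.dualBasis_repr_apply, gram_apply,
      innerₗ_apply_apply, real_inner_comm]
  rw [addHaar_convexHull_insert_zero _ b, latticeVolume_fundamentalSimplex hT, mul_one, hdet,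
    abs_of_nonneg (posDef_gram_of_linearIndependent u.linearIndependent).det_pos.le]

end SimplexVolume

/-! ### Faces of simplicial cones -/

section Faces

variable {ι V : Type*} [Fintype ι] [AddCommGroup V] [Module ℝ V]

theorem PointedCone.mem_hull_image_iff {g : ι → V} {B : Set ι} {x : V} :
    x ∈ PointedCone.hull ℝ (g '' B) ↔
      ∃ c : ι → ℝ, (∀ i, 0 ≤ c i) ∧ (∀ i, i ∉ B → c i = 0) ∧ ∑ i, c i • g i = x := by
  classical
  constructor
  · intro hx
    induction hx using Submodule.span_induction with
    | mem x hx =>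
      obtain ⟨i, hi, rfl⟩ := hx
      refine ⟨Pi.single i 1, fun j => ?_, fun j hj => ?_, by simp [Pi.single_apply]⟩
      · by_cases hji : j = i <;> simp [hji]
      · rw [Pi.single_eq_of_ne]
        rintro rfl
        exact hj hi
    | zero => exact ⟨0, fun _ => le_rfl, fun _ _ => rfl, by simp⟩
    | add x y _ _ hx hy =>
      obtain ⟨a, ha, ha0, rfl⟩ := hx
      obtain ⟨b, hb, hb0, rfl⟩ := hy
      exact ⟨a + b, fun i => add_nonneg (ha i) (hb i), fun i hi => by simp [ha0 i hi, hb0 i hi],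
        by simp [add_smul, Finset.sum_add_distrib]⟩
    | smul t x _ hx =>
      obtain ⟨a, ha, ha0, rfl⟩ := hx
      refine ⟨fun i => t * a i, fun i => mul_nonneg t.2 (ha i), fun i hi => by simp [ha0 i hi], ?_⟩
      simp only [mul_smul, ← Finset.smul_sum]
      rfl
  · rintro ⟨c, hc, hc0, rfl⟩
    refine Submodule.sum_mem _ fun i _ => ?_
    by_cases hi : i ∈ B
    · exact PointedCone.smul_mem _ (hc i) (PointedCone.subset_hull ⟨i, hi, rfl⟩)
    · rw [hc0 i hi, zero_smul]
      exact Submodule.zero_mem _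

/-- Each subfamily of a linearly independent family spans a face of the cone spanned by the
family. -/
theorem PointedCone.isFaceOf_hull_image {g : ι → V} (hg : LinearIndependent ℝ g) (B : Set ι) :
    (PointedCone.hull ℝ (g '' B)).IsFaceOf (PointedCone.hull ℝ (Set.range g)) := by
  refine ⟨Submodule.span_mono (Set.image_subset_range g B), fun {x y t} hx hy ht hxy => ?_⟩
  rw [← Set.image_univ] at hx hy
  obtain ⟨a, ha, -, rfl⟩ := PointedCone.mem_hull_image_iff.1 hx
  obtain ⟨b, hb, -, rfl⟩ := PointedCone.mem_hull_image_iff.1 hy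
  obtain ⟨c, -, hc0, hc⟩ := PointedCone.mem_hull_image_iff.1 hxy
  refine PointedCone.mem_hull_image_iff.2 ⟨a, ha, fun i hi => ?_, rfl⟩
  have hsum : ∑ j, (c j - (t * a j + b j)) • g j = 0 := by
    simp only [sub_smul, add_smul, mul_smul, Finset.sum_sub_distrib, Finset.sum_add_distrib,
      ← Finset.smul_sum, hc, sub_self]
  have hi' := Fintype.linearIndependent_iff.1 hg _ hsum i
  rw [hc0 i hi] at hi'
  have h1 := mul_nonneg ht.le (ha i)
  have h2 := hb i
  have h3 : t * a i = 0 := by linarith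
  exact (mul_eq_zero.1 h3).resolve_left ht.ne'

end Faces

/-! ### Cones of a fan as truncated simplicial cones -/

namespace MarkedFan

variable {V : Type*} [NormedAddCommGroup V] [InnerProductSpace ℝ V] {S : MarkedFan V}

theorem mem_raysOf {σ : PointedCone ℝ V} {ρ : S.Ray} : ρ ∈ S.raysOf σ ↔ ρ.1.IsFaceOf σ := by
  classical
  exact Finset.mem_filter.trans (and_iff_right (Finset.mem_univ ρ))

/-- The ray generators of a cone, as a basis of the subspace they span. -/
noncomputable def genBasis (hS : S.IsSimplicial) {σ : PointedCone ℝ V} (hσ : σ ∈ S.cones) :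
    Basis (S.raysOf σ) ℝ (S.spanOf σ) :=
  Basis.span (hS.linearIndependent_gen hσ)

theorem genBasis_eq_genIn (hS : S.IsSimplicial) {σ : PointedCone ℝ V} (hσ : σ ∈ S.cones) :
    ⇑(genBasis hS hσ) = S.genIn σ := by
  ext ρ
  exact congrArg Subtype.val (Basis.span_apply (hS.linearIndependent_gen hσ) ρ)

@[simp]
theorem coe_genBasis (hS : S.IsSimplicial) {σ : PointedCone ℝ V} (hσ : σ ∈ S.cones)
    (ρ : S.raysOf σ) : (genBasis hS hσ ρ : V) = S.gen ρ := by
  rw [genBasis_eq_genIn]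
  rfl

theorem mem_hull_gen_image_iff (hS : S.IsSimplicial) {σ : PointedCone ℝ V} (hσ : σ ∈ S.cones)
    (B : Set (S.raysOf σ)) (x : S.spanOf σ) :
    (x : V) ∈ PointedCone.hull ℝ ((fun ρ : S.raysOf σ => S.gen ρ) '' B) ↔
      (∀ ρ, 0 ≤ (genBasis hS hσ).repr x ρ) ∧ ∀ ρ, ρ ∉ B → (genBasis hS hσ).repr x ρ = 0 := by
  rw [PointedCone.mem_hull_image_iff]
  constructor
  · rintro ⟨c, hc, hc0, hcx⟩
    obtain rfl : ∑ ρ, c ρ • genBasis hS hσ ρ = x := Subtype.ext (by simpa using hcx)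
    rw [Basis.repr_sum_self]
    exact ⟨hc, hc0⟩
  · rintro ⟨hx, hx0⟩
    refine ⟨_, hx, hx0, ?_⟩
    simpa using congrArg Subtype.val ((genBasis hS hσ).sum_repr x)

theorem mem_cone_iff (hS : S.IsSimplicial) {σ : PointedCone ℝ V} (hσ : σ ∈ S.cones)
    (x : S.spanOf σ) : (x : V) ∈ σ ↔ ∀ ρ, 0 ≤ (genBasis hS hσ).repr x ρ := by
  have h := mem_hull_gen_image_iff hS hσ Set.univ x
  rw [Set.image_univ, hS.hull_gen_eq hσ] at h
  simpa using h

theorem preimage_polytope (hS : S.IsSimplicial) {σ : PointedCone ℝ V} (hσ : σ ∈ S.cones)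
    (z : S.Ray → ℝ) : (fun v : S.spanOf σ => (v : V)) ⁻¹' S.polytope σ z =
      truncatedCone (genBasis hS hσ) fun ρ => z ρ := by
  ext x
  refine and_congr (mem_cone_iff hS hσ x) ?_
  simp [Submodule.coe_inner]

/-- A pseudo-cubical vector determines the vertices of the truncated cones: the face spanned by
any set of rays of `σ` belongs to the fan. -/
theorem IsPseudoCubical.exists_isVertexSystem (hS : S.IsSimplicial) {z : S.Ray → ℝ}
    (hz : S.IsPseudoCubical z) {σ : PointedCone ℝ V} (hσ : σ ∈ S.cones) :
    ∃ w, IsVertexSystem (genBasis hS hσ) (fun ρ => z ρ) w := by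
  have key : ∀ B : Finset (S.raysOf σ), ∃ x : S.spanOf σ,
      (x : V) ∈ PointedCone.hull ℝ ((fun ρ : S.raysOf σ => S.gen ρ) '' B) ∧
        ∀ ρ ∈ B, inner ℝ x (genBasis hS hσ ρ) = z ρ := by
    intro B
    have hface := PointedCone.isFaceOf_hull_image (hS.linearIndependent_gen hσ) (B : Set _)
    rw [hS.hull_gen_eq hσ] at hface
    obtain ⟨v, hv, hvz⟩ := hz _ (S.mem_of_isFaceOf σ hσ _ hface)
    refine ⟨⟨v, ?_⟩, hv, fun ρ hρ => ?_⟩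
    · exact Submodule.span_mono (Set.image_subset_range _ _) (PointedCone.hull_le_span ℝ _ hv)
    · rw [Submodule.coe_inner, coe_genBasis]
      refine hvz ρ (mem_raysOf.2 ⟨?_, fun hx hy ht hxy =>
        (mem_raysOf.1 ρ.2).mem_of_smul_add_mem (hface.le hx) (hface.le hy) ht hxy⟩)
      rw [← S.hull_gen ρ]
      refine Submodule.span_mono ?_
      rintro _ rfl
      exact ⟨ρ, hρ, rfl⟩
  choose w hw hwz using key
  exact ⟨w, fun B => ((mem_hull_gen_image_iff hS hσ B _).1 (hw B)).1,
    fun B => ((mem_hull_gen_image_iff hS hσ B _).1 (hw B)).2, hwz⟩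

theorem card_raysOf (hS : S.IsSimplicial) {k : ℕ} {σ : PointedCone ℝ V}
    (hσ : σ ∈ S.conesOfDim k) : Fintype.card (S.raysOf σ) = k := by
  rw [← finrank_span_eq_card (hS.linearIndependent_gen hσ.1), ← hσ.2, coneDim]
  suffices h : Submodule.span ℝ (Set.range fun ρ : S.raysOf σ => S.gen ρ) =
      Submodule.span ℝ (σ : Set V) by rw [h]
  refine le_antisymm (Submodule.span_mono ?_) (Submodule.span_le.2 fun v hv => ?_)
  · exact PointedCone.subset_hull.trans (hS.hull_gen_eq hσ.1).le
  · rw [← hS.hull_gen_eq hσ.1] at hv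
    exact PointedCone.hull_le_span ℝ _ hv

/-! ### Gram matrices of initial sets of rays -/

/-- The bijection between the initial rays of a labeling of the rays of `σ`, as rays of `σ` and as
rays of the fan. -/
noncomputable def initialIndicesEquiv {k : ℕ} {σ : PointedCone ℝ V} (f : S.Labeling k σ)
    (j : Fin k) : initialIndices f (j + 1) ≃ initialRays f j :=
  Equiv.ofBijective
    (fun ρ => ⟨ρ.1.1, by
      classical
      refine Finset.mem_image.2 ⟨f.symm ρ.1, ?_, by simp⟩
      have := mem_initialIndices.1 ρ.2
      simp only [Finset.mem_filter, Finset.mem_univ, true_and, Fin.le_def]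
      omega⟩)
    ⟨fun ρ η h => by
      have h' : ρ.1.1 = η.1.1 := congrArg (fun x : initialRays f j => x.1) h
      exact Subtype.ext (Subtype.ext h'), fun ⟨ρ, hρ⟩ => by
      classical
      obtain ⟨i, hi, rfl⟩ := Finset.mem_image.1 hρ
      refine ⟨⟨f i, ?_⟩, rfl⟩
      simpa [Nat.lt_succ_iff] using hi⟩

open Classical in
theorem det_gramMatrix_initialRays (hS : S.IsSimplicial) {k : ℕ} {σ : PointedCone ℝ V}
    (hσ : σ ∈ S.cones) (f : S.Labeling k σ) (j : Fin k) :
    (S.gramMatrix (initialRays f j)).det =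
      (gram ℝ fun ρ : initialIndices f (j + 1) => genBasis hS hσ ρ).det := by
  rw [← det_submatrix_equiv_self (initialIndicesEquiv f j)]
  congr 1
  ext ρ η
  rw [gram_apply, Submodule.coe_inner, coe_genBasis, coe_genBasis]
  rfl

open Classical in
theorem det_gramMatrixReplace_initialRays (hS : S.IsSimplicial) {k : ℕ} {σ : PointedCone ℝ V}
    (hσ : σ ∈ S.cones) (z : S.Ray → ℝ) (f : S.Labeling k σ) (j : Fin k) :
    (S.gramMatrixReplace (initialRays f j) ⟨(f j).1, mem_initialRays f j⟩ z).det =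
      ((gram ℝ fun ρ : initialIndices f (j + 1) => genBasis hS hσ ρ).updateCol
        ⟨f j, by simp⟩ fun ρ => z ρ.1).det := by
  rw [← det_submatrix_equiv_self (initialIndicesEquiv f j)]
  congr 1
  ext ρ η
  have hη : initialIndicesEquiv f j η = ⟨(f j).1, mem_initialRays f j⟩ ↔ η = ⟨f j, by simp⟩ :=
    (initialIndicesEquiv f j).apply_eq_iff_eq (y := ⟨f j, by simp⟩)
  rw [submatrix_apply, gramMatrixReplace, updateCol_apply, updateCol_apply, gram_apply,
    Submodule.coe_inner, coe_genBasis, coe_genBasis]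
  exact if_congr hη rfl rfl

end MarkedFan

open Classical in
theorem mainTheorem3 {V : Type*} [NormedAddCommGroup V] [InnerProductSpace ℝ V]
    [FiniteDimensional ℝ V] [MeasurableSpace V] [BorelSpace V]
    (S : MarkedFan V) (hS : S.IsSimplicial)
    (z : S.Ray → ℝ) (hz : S.IsPseudoCubical z)
    (k : ℕ) (σ : PointedCone ℝ V) (hσ : σ ∈ S.conesOfDim k) :
    S.vol σ (S.polytope σ z) =
      (S.gramMatrix (S.raysOf σ)).det *
        ∑ f : S.Labeling k σ, ∏ j : Fin k,
          (S.gramMatrixReplace (MarkedFan.initialRays f j)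
              ⟨(f j).1, MarkedFan.mem_initialRays f j⟩ z).det /
            (S.gramMatrix (MarkedFan.initialRays f j)).det := by
  obtain ⟨w, hw⟩ := hz.exists_isVertexSystem hS hσ.1
  have hk : Nonempty (Fin k ≃ S.raysOf σ) :=
    ⟨(Fintype.equivFinOfCardEq (MarkedFan.card_raysOf hS hσ)).symm⟩
  set u := MarkedFan.genBasis hS hσ.1 with hu
  have hL : S.latticeOf σ = Submodule.span ℤ (Set.range u) := by
    rw [hu, MarkedFan.genBasis_eq_genIn]
    rfl
  obtain ⟨T, hT⟩ := hS.exists_isFundamentalSimplex hσ.1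
  have := isAddHaarMeasure_latticeVolume hT
  have hG : S.gramMatrix (S.raysOf σ) = gram ℝ u := by
    ext ρ η
    rw [gram_apply, Submodule.coe_inner, MarkedFan.coe_genBasis, MarkedFan.coe_genBasis]
    rfl
  rw [MarkedFan.vol, MarkedFan.preimage_polytope hS hσ.1, measureReal_def,
    hw.addHaar_truncatedCone _ hk, hL, latticeVolume_convexHull_basis, ENNReal.toReal_mul,
    ENNReal.toReal_ofReal (posDef_gram_of_linearIndependent u.linearIndependent).det_pos.le,
    ENNReal.toReal_ofReal (Finset.sum_nonneg fun f _ => Finset.prod_nonneg fun j _ =>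
      hw.repr_nonneg _ _), mul_comm, hG]
  congr 1
  refine Finset.sum_congr rfl fun f _ => Finset.prod_congr rfl fun j _ => ?_
  rw [MarkedFan.det_gramMatrix_initialRays hS hσ.1,
    MarkedFan.det_gramMatrixReplace_initialRays hS hσ.1]
  exact hw.repr_eq_det_div_det _ ⟨f j, by simp⟩
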